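/- Let $\mathbb K\in\{\mathbb R,\mathbb C\}$. Topological vector spaces over $\mathbb K$ and locally convex spaces are not assumed to be Hausdorff. A Hausdorff topological space $X$ is a *$k_\omega$-space* if there are compact subsets $K_1\subseteq K_2\subseteq\cdots$ of $X$ with $X=\bigcup_n K_n$ such that $X=\varinjlim K_n$ as a topological space, i.e. a set $U\subseteq X$ is open whenever $U\cap K_n$ is relatively open in $K_n$ for all $n$. For a topological vector space $F$, its *convexification* $F_{\mathrm{lcx}}$ is the vector space $F$ with the finest locally convex vector topology coarser than the given one. A *Silva space* (DFS-space) is a locally convex space which is the locally convex direct limit of an ascending sequence $E_1\subseteq E_2\subseteq\cdots$ of Banach spaces all of whose inclusion maps $E_n\to E_{n+1}$ are compact operators. For a locally convex space $E$ let $T^0_\pi(E):=\mathbb K$, $T^1_\pi(E):=E$ and $T^{j+1}_\pi(E):=E\otimes_\pi T^j_\pi(E)$ for $j\ge 1$, where $\otimes_\pi$ is the tensor product with the projective tensor product topology (the finest locally convex vector topology making $(x,y)\mapsto x\otimes y$ continuous). Let $T_\pi(E):=\bigoplus_{j\ge 0}T^j_\pi(E)$ be the tensor algebra of $E$, topologized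 as the locally convex direct sum. It is called a *topological algebra* if its multiplication $T_\pi(E)\times T_\pi(E)\to T_\pi(E)$ is continuous. **Proposition.** Let $E$ be a locally convex space over $\mathbb K$. 1. If $E=F_{\mathrm{lcx}}$ for a topological vector space $F$ whose underlying topological space is a $k_\omega$-space, then $T_\pi(E)$ is a topological algebra. 2. In particular, if $E$ is a $k_\omega$-space, then $T_\pi(E)$ is a topological algebra. 3. For example, if $E$ is a Silva space, then $E$ is a $k_\omega$-space and $T_\pi(E)$ is a topological algebra. -/

import Mathlib

open scoped TensorProduct DirectSum ComplexOrder Topology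

universe u v

/-- `t` is a vector topology on `V`: addition, negation and scalar multiplication are continuous.
Vector topologies need not be Hausdorff. -/
structure IsVectorTopology (𝕜 : Type*) [RCLike 𝕜] {V : Type*} [AddCommGroup V] [Module 𝕜 V]
    (t : TopologicalSpace V) : Prop where
  isTopologicalAddGroup : @IsTopologicalAddGroup V t _
  continuousSMul : @ContinuousSMul 𝕜 V _ _ t

/-- `t` is a locally convex vector topology on `V`. Convexity is over `𝕜` with the order in which
the nonnegative scalars are exactly the nonnegative reals, so it is the usual (real) convexity. -/
structure IsLocallyConvexTopology (𝕜 : Type*) [RCLike 𝕜] {V : Type*} [AddCommGroup V]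
    [Module 𝕜 V] (t : TopologicalSpace V) : Prop extends IsVectorTopology 𝕜 t where
  locallyConvex : @LocallyConvexSpace 𝕜 V _ _ _ _ t

/-- The supremum of locally convex vector topologies (an infimum in the order of Mathlib, where
`s ≤ t` means that `s` is finer than `t`) is a locally convex vector topology. -/
theorem IsLocallyConvexTopology.sInf {𝕜 : Type*} [RCLike 𝕜] {V : Type*} [AddCommGroup V]
    [Module 𝕜 V] {S : Set (TopologicalSpace V)} (h : ∀ t ∈ S, IsLocallyConvexTopology 𝕜 t) :
    IsLocallyConvexTopology 𝕜 (sInf S) where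
  isTopologicalAddGroup := topologicalAddGroup_sInf fun t ht => (h t ht).isTopologicalAddGroup
  continuousSMul := continuousSMul_sInf fun t ht => (h t ht).continuousSMul
  locallyConvex := LocallyConvexSpace.sInf fun t ht => (h t ht).locallyConvex

/-- The convexification: the finest locally convex vector topology which is coarser than `t`. -/
def convexification (𝕜 : Type*) [RCLike 𝕜] {V : Type*} [AddCommGroup V] [Module 𝕜 V]
    (t : TopologicalSpace V) : TopologicalSpace V :=
  sInf {s | IsLocallyConvexTopology 𝕜 s ∧ t ≤ s}

theorem isLeast_convexification (𝕜 : Type*) [RCLike 𝕜] {V : Type*} [AddCommGroup V]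
    [Module 𝕜 V] (t : TopologicalSpace V) :
    IsLeast {s | IsLocallyConvexTopology 𝕜 s ∧ t ≤ s} (convexification 𝕜 t) :=
  ⟨⟨.sInf fun _ hs => hs.1, le_sInf fun _ hs => hs.2⟩, fun _ hs => sInf_le hs⟩

/-- The finest locally convex vector topology on `V` making all the given maps `f i : X i → V`
continuous, where `X i` carries the topology `tX i`. -/
def finestLocallyConvex (𝕜 : Type*) [RCLike 𝕜] {V : Type*} [AddCommGroup V] [Module 𝕜 V]
    {ι : Type*} {X : ι → Type*} (tX : ∀ i, TopologicalSpace (X i)) (f : ∀ i, X i → V) :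
    TopologicalSpace V :=
  sInf {s | IsLocallyConvexTopology 𝕜 s ∧ ∀ i, Continuous[tX i, s] (f i)}

theorem isLeast_finestLocallyConvex (𝕜 : Type*) [RCLike 𝕜] {V : Type*} [AddCommGroup V]
    [Module 𝕜 V] {ι : Type*} {X : ι → Type*} (tX : ∀ i, TopologicalSpace (X i))
    (f : ∀ i, X i → V) :
    IsLeast {s | IsLocallyConvexTopology 𝕜 s ∧ ∀ i, Continuous[tX i, s] (f i)}
      (finestLocallyConvex 𝕜 tX f) :=
  ⟨⟨.sInf fun _ hs => hs.1, fun i => continuous_sInf_rng.2 fun _ hs => hs.2 i⟩,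
    fun _ hs => sInf_le hs⟩

/-- The projective tensor product topology on `E ⊗ F`: the finest locally convex vector topology
making the bilinear map `(x, y) ↦ x ⊗ y` from `E × F` continuous. -/
def projectiveTopology (𝕜 : Type*) [RCLike 𝕜] {E F : Type*} [AddCommGroup E] [Module 𝕜 E]
    [AddCommGroup F] [Module 𝕜 F] (tE : TopologicalSpace E) (tF : TopologicalSpace F) :
    TopologicalSpace (E ⊗[𝕜] F) :=
  finestLocallyConvex 𝕜 (fun _ : Unit => @instTopologicalSpaceProd E F tE tF)
    (fun _ (p : E × F) => p.1 ⊗ₜ[𝕜] p.2)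

/-- The canonical isomorphism `E ⊗ Tⁿ(E) ≃ Tⁿ⁺¹(E)`. -/
noncomputable def tensorPowerCons (𝕜 : Type*) [RCLike 𝕜] (E : Type*) [AddCommGroup E]
    [Module 𝕜 E] (n : ℕ) : E ⊗[𝕜] (⨂[𝕜]^n E) ≃ₗ[𝕜] ⨂[𝕜]^(n + 1) E :=
  (TensorProduct.congr (PiTensorProduct.subsingletonEquiv (R := 𝕜) (s := fun _ => E)
      (0 : Fin 1)).symm (LinearEquiv.refl 𝕜 (⨂[𝕜]^n E))).trans
    ((TensorPower.mulEquiv (R := 𝕜) (M := E) (n := 1) (m := n)).trans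
      (TensorPower.cast 𝕜 E (add_comm 1 n)))

theorem tensorPowerCons_tmul_tprod (𝕜 : Type*) [RCLike 𝕜] (E : Type*) [AddCommGroup E]
    [Module 𝕜 E] (n : ℕ) (x : E) (v : Fin n → E) :
    tensorPowerCons 𝕜 E n (x ⊗ₜ[𝕜] PiTensorProduct.tprod 𝕜 v) =
      PiTensorProduct.tprod 𝕜 (Fin.cons x v : Fin (n + 1) → E) := by
  simp only [tensorPowerCons, LinearEquiv.trans_apply, TensorProduct.congr_tmul,
    PiTensorProduct.subsingletonEquiv_symm_apply', LinearEquiv.refl_apply]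
  rw [← TensorPower.gMul_def, TensorPower.tprod_mul_tprod, TensorPower.cast_tprod]
  congr 1
  funext i
  simp [Fin.append_left_eq_cons]

/-- The topology of the projective tensor power: `T⁰(E) = 𝕜`, `T¹(E) = E`, and
`Tⁿ⁺²(E) = E ⊗ Tⁿ⁺¹(E)` with the projective tensor product topology (up to the canonical
isomorphisms). -/
noncomputable def tensorPowerTopology (𝕜 : Type*) [RCLike 𝕜] {E : Type*} [AddCommGroup E]
    [Module 𝕜 E] (tE : TopologicalSpace E) : (n : ℕ) → TopologicalSpace (⨂[𝕜]^n E)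
  | 0 => TopologicalSpace.induced
      (PiTensorProduct.isEmptyEquiv (R := 𝕜) (s := fun _ => E) (Fin 0)) inferInstance
  | 1 => TopologicalSpace.induced
      (PiTensorProduct.subsingletonEquiv (R := 𝕜) (s := fun _ => E) (0 : Fin 1)) tE
  | n + 2 => TopologicalSpace.induced (tensorPowerCons 𝕜 E (n + 1)).symm
      (projectiveTopology 𝕜 tE (tensorPowerTopology 𝕜 tE (n + 1)))

/-- The topology of the tensor algebra `T_π(E)`, as the locally convex direct sum of the
projective tensor powers: the finest locally convex vector topology making all inclusions of the
summands continuous. -/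
noncomputable def tensorAlgebraTopology (𝕜 : Type*) [RCLike 𝕜] {E : Type*} [AddCommGroup E]
    [Module 𝕜 E] (tE : TopologicalSpace E) : TopologicalSpace (⨁ n, ⨂[𝕜]^n E) :=
  finestLocallyConvex 𝕜 (tensorPowerTopology 𝕜 tE)
    (fun n => DirectSum.lof 𝕜 ℕ (fun n => ⨂[𝕜]^n E) n)

/-- `A` with the topology `t` and the multiplication `β` is a topological algebra: `t` is a vector
topology and the bilinear map `β : A × A → A` is (jointly) continuous. -/
structure IsTopologicalAlgebraTopology (𝕜 : Type*) [RCLike 𝕜] {A : Type*} [AddCommGroup A]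
    [Module 𝕜 A] (β : A →ₗ[𝕜] A →ₗ[𝕜] A) (t : TopologicalSpace A) : Prop
    extends IsVectorTopology 𝕜 t where
  continuous_mul : Continuous[@instTopologicalSpaceProd A A t t, t] (fun p : A × A => β p.1 p.2)

/-- `T_π(E)`, for `E` with the topology `tE`, is a topological algebra with respect to the usual
(concatenation) multiplication of the tensor algebra `T(E) = ⨁ₙ Tⁿ(E)`. -/
def TensorAlgebraIsTopological (𝕜 : Type*) [RCLike 𝕜] {E : Type*} [AddCommGroup E] [Module 𝕜 E]
    (tE : TopologicalSpace E) : Prop :=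
  IsTopologicalAlgebraTopology 𝕜 (LinearMap.mul 𝕜 (⨁ n, ⨂[𝕜]^n E))
    (tensorAlgebraTopology 𝕜 tE)

/-- A `k_ω`-space: a Hausdorff space which is the direct limit, as a topological space, of an
ascending sequence of compact subsets covering it. -/
structure IsKOmegaSpace (X : Type*) [TopologicalSpace X] : Prop where
  t2Space : T2Space X
  exists_seq : ∃ K : ℕ → Set X, Monotone K ∧ (∀ n, IsCompact (K n)) ∧ (⋃ n, K n) = Set.univ ∧
    ∀ U : Set X, (∀ n, IsOpen ((↑) ⁻¹' U : Set (K n))) → IsOpen U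

/-- `E` with its topology is a Silva space (DFS-space): the locally convex direct limit of an
ascending sequence of Banach spaces `B 0 ⊆ B 1 ⊆ ⋯` with compact inclusion maps. The inclusions
are written as injective linear maps `incl n : B n → B (n + 1)` and `f n : B n → E`. -/
def IsSilvaSpace (𝕜 : Type u) [RCLike 𝕜] (E : Type v) [AddCommGroup E] [Module 𝕜 E]
    [tE : TopologicalSpace E] : Prop :=
  ∃ (B : ℕ → Type v) (_ : ∀ n, NormedAddCommGroup (B n)) (_ : ∀ n, NormedSpace 𝕜 (B n))
    (incl : ∀ n, B n →L[𝕜] B (n + 1)) (f : ∀ n, B n →ₗ[𝕜] E),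
    (∀ n, CompleteSpace (B n)) ∧
    (∀ n, IsCompactOperator (incl n)) ∧
    (∀ n, Function.Injective (f n)) ∧
    (∀ n x, f (n + 1) (incl n x) = f n x) ∧
    (∀ y : E, ∃ n x, f n x = y) ∧
    tE = finestLocallyConvex 𝕜 (fun n => (inferInstance : TopologicalSpace (B n))) (fun n => (f n : B n → E))

/-! Everything reduces to a countability condition on `E`: for continuous seminorms `q n` there are
one continuous seminorm `r` and constants `C n` with `q n ≤ C n * r`. Given it, let `p` be a
continuous seminorm on the tensor algebra. On pure tensors of degree `n`, `p` is at most a constant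
times `∏ q n (v i)` (`exists_seminorm_tprod_le`), hence at most `N n * ∏ r (v i)` with `N`
increasing and `≥ 1`. Then `N (m + n) ≤ N (2 * m) * N (2 * n)`, so the greatest seminorm `Q` bounded
by `N (2 * n) * ∏ r (v i)` on pure tensors satisfies `p (x * y) ≤ Q x * Q y`, and `Q` is continuous
because it is so on each summand.

On a `k_ω`-space the condition holds by a diagonal choice of weights: `r = ∑ a n * q n` converges
uniformly on each compact set of the sequence, hence is continuous. A seminorm continuous for a
vector topology is continuous for its convexification, which gives the first two claims.

For Silva spaces, compactness of the inclusions shows that the locally convex limit topology is also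
the topological limit of the steps (`isOpen_of_forall_isOpen_preimage`); closures of images of balls
then supply the compact sets. -/

section SeminormTopology

/-! ### Seminorms and finest locally convex topologies -/

variable {𝕜 : Type*} [RCLike 𝕜] {V : Type*} [AddCommGroup V] [Module 𝕜 V]

/-- The vector topology defined by a single seminorm. -/
@[reducible] def Seminorm.topology (p : Seminorm 𝕜 V) : TopologicalSpace V :=
  p.toAddGroupSeminorm.toSeminormedAddCommGroup.toUniformSpace.toTopologicalSpace

theorem Seminorm.isLocallyConvexTopology_topology (p : Seminorm 𝕜 V) :
    IsLocallyConvexTopology 𝕜 p.topology := by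
  let : SeminormedAddCommGroup V := p.toAddGroupSeminorm.toSeminormedAddCommGroup
  let : NormedSpace 𝕜 V := { norm_smul_le := fun a x => (map_smul_eq_mul p a x).le }
  let : Module ℝ V := Module.compHom V (algebraMap ℝ 𝕜)
  have : IsScalarTower ℝ 𝕜 V := ⟨fun a b x => by
    rw [Algebra.smul_def, mul_smul]; rfl⟩
  refine ⟨⟨inferInstance, inferInstance⟩, LocallyConvexSpace.ofBases 𝕜 V Metric.ball
    (fun _ => (0 < ·)) (fun _ => Metric.nhds_basis_ball) fun x r _ => ?_⟩
  refine convex_of_nonneg_surjective_algebraMap (R := ℝ) _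
    (fun _ => RCLike.nonneg_iff_exists_ofReal.mp) ?_
  have hb : Metric.ball x r = p.ball x r := by
    ext y
    rw [mem_ball_iff_norm, Seminorm.mem_ball]
    rfl
  rw [hb]
  exact p.convex_ball x r

theorem Seminorm.continuous_topology (p : Seminorm 𝕜 V) : Continuous[p.topology, _] p := by
  let : SeminormedAddCommGroup V := p.toAddGroupSeminorm.toSeminormedAddCommGroup
  exact continuous_norm

theorem Seminorm.continuous_topology_rng (p : Seminorm 𝕜 V) {X : Type*} [TopologicalSpace X]
    {f : X → V} (hf : ∀ x, Filter.Tendsto (fun y => p (f y - f x)) (𝓝 x) (𝓝 0)) :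
    Continuous[_, p.topology] f := by
  let : SeminormedAddCommGroup V := p.toAddGroupSeminorm.toSeminormedAddCommGroup
  exact continuous_iff_continuousAt.2 fun x => tendsto_iff_norm_sub_tendsto_zero.2 (hf x)

/-- The topology of `p` alone is a competitor in the infimum defining the finest topology, so no
description of neighbourhoods is needed. -/
theorem Seminorm.continuous_finestLocallyConvex {ι : Type*} {X : ι → Type*}
    {tX : ∀ i, TopologicalSpace (X i)} {f : ∀ i, X i → V} (p : Seminorm 𝕜 V)
    (h : ∀ i x, Filter.Tendsto (fun y => p (f i y - f i x)) (𝓝 x) (𝓝 0)) :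
    Continuous[finestLocallyConvex 𝕜 tX f, _] p :=
  continuous_le_dom ((isLeast_finestLocallyConvex 𝕜 tX f).2
    ⟨p.isLocallyConvexTopology_topology, fun i => p.continuous_topology_rng (h i)⟩)
    p.continuous_topology

theorem Seminorm.continuous_finestLocallyConvex_of_comp {ι : Type*} {X : ι → Type*}
    {tX : ∀ i, TopologicalSpace (X i)} [∀ i, AddCommGroup (X i)] [∀ i, Module 𝕜 (X i)]
    [∀ i, IsTopologicalAddGroup (X i)] {f : ∀ i, X i →ₗ[𝕜] V} (p : Seminorm 𝕜 V)
    (h : ∀ i, Continuous fun x => p (f i x)) :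
    Continuous[finestLocallyConvex 𝕜 tX (fun i => f i), _] p := by
  refine p.continuous_finestLocallyConvex fun i x => ?_
  have : Continuous fun y => p (f i (y - x)) := (h i).comp (continuous_id.sub continuous_const)
  simpa using this.tendsto x

theorem IsLocallyConvexTopology.polynormableSpace {t : TopologicalSpace V}
    (h : IsLocallyConvexTopology 𝕜 t) : PolynormableSpace 𝕜 V := by
  let : Module ℝ V := Module.compHom V (algebraMap ℝ 𝕜)
  have : IsScalarTower ℝ 𝕜 V := ⟨fun a b x => by
    rw [Algebra.smul_def, mul_smul]; rfl⟩
  have := h.isTopologicalAddGroup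
  have := h.continuousSMul
  have := h.locallyConvex
  have : ContinuousSMul ℝ V := IsScalarTower.continuousSMul 𝕜
  infer_instance

end SeminormTopology

/-! ### Continuity of bilinear maps through seminorms -/

section Bilinear

variable {𝕜 : Type*} [RCLike 𝕜] {E F W : Type*} [AddCommGroup E] [Module 𝕜 E]
  [AddCommGroup F] [Module 𝕜 F] [AddCommGroup W] [Module 𝕜 W]
  [TopologicalSpace E] [TopologicalSpace F]

theorem tendsto_seminorm_bilinear_sub [IsTopologicalAddGroup E] [IsTopologicalAddGroup F]
    (β : E →ₗ[𝕜] F →ₗ[𝕜] W) (p : Seminorm 𝕜 W) {q : Seminorm 𝕜 E} {r : Seminorm 𝕜 F}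
    (hq : Continuous q) (hr : Continuous r) (h : ∀ x y, p (β x y) ≤ q x * r y) (z : E × F) :
    Filter.Tendsto (fun w : E × F => p (β w.1 w.2 - β z.1 z.2)) (𝓝 z) (𝓝 0) := by
  have hc : Continuous fun w : E × F => q (w.1 - z.1) * r w.2 + q z.1 * r (w.2 - z.2) := by
    fun_prop
  refine squeeze_zero (fun _ => apply_nonneg p _) (fun w => ?_) (by simpa using hc.tendsto z)
  have : β w.1 w.2 - β z.1 z.2 = β (w.1 - z.1) w.2 + β z.1 (w.2 - z.2) := by simp
  rw [this]
  exact (map_add_le_add p _ _).trans (add_le_add (h _ _) (h _ _))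

theorem continuous_bilinear_of_seminorm [IsTopologicalAddGroup E] [IsTopologicalAddGroup F]
    [TopologicalSpace W] [PolynormableSpace 𝕜 W] (β : E →ₗ[𝕜] F →ₗ[𝕜] W)
    (h : ∀ p : Seminorm 𝕜 W, Continuous p → ∃ (q : Seminorm 𝕜 E) (r : Seminorm 𝕜 F),
      Continuous q ∧ Continuous r ∧ ∀ x y, p (β x y) ≤ q x * r y) :
    Continuous fun z : E × F => β z.1 z.2 := by
  refine continuous_iff_continuousAt.2 fun z =>
    ((PolynormableSpace.withSeminorms 𝕜 W).tendsto_nhds _ _).2 fun p ε hε => ?_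
  obtain ⟨q, r, hq, hr, hp⟩ := h p.1 p.2
  exact (tendsto_seminorm_bilinear_sub β p.1 hq hr hp z).eventually (gt_mem_nhds hε)

theorem PolynormableSpace.exists_seminorm_ball_subset [PolynormableSpace 𝕜 E] {U : Set E}
    (hU : U ∈ 𝓝 (0 : E)) : ∃ q : Seminorm 𝕜 E, Continuous q ∧ ∀ x, q x < 1 → x ∈ U := by
  have hs := PolynormableSpace.withSeminorms 𝕜 E
  obtain ⟨s, r, hr, hsub⟩ := (hs.mem_nhds_iff 0 U).1 hU
  have : IsTopologicalAddGroup E := hs.topologicalAddGroup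
  have hc : Continuous (s.sup fun p : {p : Seminorm 𝕜 E // Continuous p} => p.1 : Seminorm 𝕜 E) :=
    Seminorm.continuous_finsetSup fun i _ => i.2
  refine ⟨r⁻¹.toNNReal • (s.sup fun p => p.1 : Seminorm 𝕜 E), ?_, fun x hx => hsub ?_⟩
  · exact hc.const_smul r⁻¹.toNNReal
  · rw [Seminorm.mem_ball_zero]
    rw [smul_apply, NNReal.smul_def, smul_eq_mul, Real.coe_toNNReal _ (by positivity), inv_mul_lt_iff₀ hr,
      mul_one] at hx
    exact hx

theorem exists_seminorm_le_mul_of_continuous_bilinear [PolynormableSpace 𝕜 E]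
    [PolynormableSpace 𝕜 F] (β : E →ₗ[𝕜] F →ₗ[𝕜] W) (p : Seminorm 𝕜 W)
    (h : Continuous fun z : E × F => p (β z.1 z.2)) : ∃ (q : Seminorm 𝕜 E) (r : Seminorm 𝕜 F),
      Continuous q ∧ Continuous r ∧ ∀ x y, p (β x y) ≤ q x * r y := by
  have hN : (fun z : E × F => p (β z.1 z.2)) ⁻¹' Set.Iio 1 ∈ 𝓝 ((0, 0) : E × F) :=
    (isOpen_Iio.preimage h).mem_nhds (by simp)
  rw [nhds_prod_eq, Filter.mem_prod_iff] at hN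
  obtain ⟨U, hU, U', hU', hsub⟩ := hN
  obtain ⟨q, hq, hqU⟩ := PolynormableSpace.exists_seminorm_ball_subset (𝕜 := 𝕜) hU
  obtain ⟨r, hr, hrU⟩ := PolynormableSpace.exists_seminorm_ball_subset (𝕜 := 𝕜) hU'
  -- Homogeneity: for `a > q x` and `b > r y`, the vectors `x / a` and `y / b` lie in the unit
  -- balls. Strict inequalities cover vanishing seminorms.
  refine ⟨q, r, hq, hr, fun x y => le_mul_of_forall_lt₀ fun a ha b hb => ?_⟩
  have ha0 : 0 < a := (apply_nonneg q x).trans_lt ha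
  have hb0 : 0 < b := (apply_nonneg r y).trans_lt hb
  have hx : q (((a⁻¹ : ℝ) : 𝕜) • x) < 1 := by
    rw [map_smul_eq_mul, RCLike.norm_ofReal, abs_of_pos (by positivity), inv_mul_lt_iff₀ ha0]
    simpa
  have hy : r (((b⁻¹ : ℝ) : 𝕜) • y) < 1 := by
    rw [map_smul_eq_mul, RCLike.norm_ofReal, abs_of_pos (by positivity), inv_mul_lt_iff₀ hb0]
    simpa
  have := @hsub (_, _) ⟨hqU _ hx, hrU _ hy⟩
  simp only [Set.mem_preimage, Set.mem_Iio, map_smul, LinearMap.smul_apply] at this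
  rw [map_smul_eq_mul, map_smul_eq_mul, RCLike.norm_ofReal, RCLike.norm_ofReal,
    abs_of_pos (by positivity), abs_of_pos (by positivity), inv_mul_lt_iff₀ (by positivity),
    inv_mul_lt_iff₀ (by positivity), mul_one] at this
  linarith

end Bilinear

/-! ### Greatest seminorms with prescribed bounds on a spanning family -/

section GreatestSeminorm

variable {𝕜 : Type*} [RCLike 𝕜] {V W Z : Type*} [AddCommGroup V] [Module 𝕜 V]
  [AddCommGroup W] [Module 𝕜 W] [AddCommGroup Z] [Module 𝕜 Z] {ι κ : Type*}

/-- The greatest seminorm whose values at the vectors `g i` are bounded by the numbers `c i`.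
It is only meaningful if the vectors `g i` span the space and the `c i` are nonnegative. -/
noncomputable def greatestSeminorm (𝕜 : Type*) [RCLike 𝕜] {V : Type*} [AddCommGroup V]
    [Module 𝕜 V] (g : ι → V) (c : ι → ℝ) : Seminorm 𝕜 V :=
  sSup {p | ∀ i, p (g i) ≤ c i}

/-- `sSup` of seminorms is the pointwise supremum only for a bounded family; expanding a vector in
the generators bounds all its values at once. -/
theorem bddAbove_seminorms_of_span_eq_top {g : ι → V} (hg : Submodule.span 𝕜 (Set.range g) = ⊤)
    (c : ι → ℝ) : BddAbove {p : Seminorm 𝕜 V | ∀ i, p (g i) ≤ c i} := by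
  suffices h : ∀ x, ∃ C, ∀ p : Seminorm 𝕜 V, (∀ i, p (g i) ≤ c i) → p x ≤ C by
    choose C hC using h
    refine Seminorm.bddAbove_iff.2 ⟨C, ?_⟩
    rintro _ ⟨p, hp, rfl⟩ x
    exact hC x p hp
  intro x
  have hx : x ∈ Submodule.span 𝕜 (Set.range g) := hg ▸ Submodule.mem_top
  induction hx using Submodule.span_induction with
  | mem x h =>
    obtain ⟨i, rfl⟩ := h
    exact ⟨c i, fun p hp => hp i⟩
  | zero => exact ⟨0, fun p _ => (map_zero p).le⟩
  | add x y _ _ hx hy =>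
    obtain ⟨C, hC⟩ := hx
    obtain ⟨D, hD⟩ := hy
    exact ⟨C + D, fun p hp => (map_add_le_add p x y).trans (add_le_add (hC p hp) (hD p hp))⟩
  | smul a x _ hx =>
    obtain ⟨C, hC⟩ := hx
    refine ⟨‖a‖ * C, fun p hp => ?_⟩
    rw [map_smul_eq_mul]
    exact mul_le_mul_of_nonneg_left (hC p hp) (norm_nonneg a)

theorem greatestSeminorm_apply_le {g : ι → V} {c : ι → ℝ}
    (hg : Submodule.span 𝕜 (Set.range g) = ⊤) (hc : ∀ i, 0 ≤ c i) (i : ι) :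
    greatestSeminorm 𝕜 g c (g i) ≤ c i := by
  rw [greatestSeminorm, Seminorm.sSup_apply (bddAbove_seminorms_of_span_eq_top hg c)]
  exact Real.iSup_le (fun p => p.2 i) (hc i)

theorem le_greatestSeminorm {g : ι → V} {c : ι → ℝ} (hg : Submodule.span 𝕜 (Set.range g) = ⊤)
    {p : Seminorm 𝕜 V} (hp : ∀ i, p (g i) ≤ c i) (x : V) : p x ≤ greatestSeminorm 𝕜 g c x :=
  (le_csSup (bddAbove_seminorms_of_span_eq_top hg c) hp : p ≤ greatestSeminorm 𝕜 g c) x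

theorem le_mul_greatestSeminorm {g : ι → V} {c : ι → ℝ}
    (hg : Submodule.span 𝕜 (Set.range g) = ⊤) (hc : ∀ i, 0 ≤ c i) {p : Seminorm 𝕜 V} {C : ℝ}
    (hC : 0 ≤ C) (hp : ∀ i, p (g i) ≤ C * c i) (x : V) :
    p x ≤ C * greatestSeminorm 𝕜 g c x := by
  -- `C` may be zero, so `p` is divided by every `a > C` instead.
  refine le_mul_of_forall_lt₀ fun a ha b hb => ?_
  have ha0 : 0 < a := hC.trans_lt ha
  have key : a⁻¹ * p x ≤ greatestSeminorm 𝕜 g c x := by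
    have := le_greatestSeminorm (c := c) hg (p := a⁻¹.toNNReal • p) (fun i => ?_) x
    · simpa [NNReal.smul_def, ha0.le] using this
    · have h := (hp i).trans (mul_le_mul_of_nonneg_right ha.le (hc i))
      simpa [NNReal.smul_def, ha0.le, inv_mul_le_iff₀ ha0] using h
  rw [inv_mul_le_iff₀ ha0] at key
  exact key.trans (mul_le_mul_of_nonneg_left hb.le ha0.le)

/-- Fixing one variable turns `p ∘ β` into a seminorm in the other, so the bound passes from
generators to all vectors one variable at a time. -/
theorem seminorm_bilinear_le_greatestSeminorm {g : ι → V} {c : ι → ℝ} {h : κ → W} {d : κ → ℝ}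
    (hg : Submodule.span 𝕜 (Set.range g) = ⊤) (hc : ∀ i, 0 ≤ c i)
    (hh : Submodule.span 𝕜 (Set.range h) = ⊤) (hd : ∀ j, 0 ≤ d j)
    (β : V →ₗ[𝕜] W →ₗ[𝕜] Z) (p : Seminorm 𝕜 Z) (hp : ∀ i j, p (β (g i) (h j)) ≤ c i * d j)
    (x : V) (y : W) :
    p (β x y) ≤ greatestSeminorm 𝕜 g c x * greatestSeminorm 𝕜 h d y := by
  refine le_mul_greatestSeminorm hh hd (p := p.comp (β x)) (apply_nonneg _ x) (fun j => ?_) y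
  rw [mul_comm]
  refine le_mul_greatestSeminorm hg hc (p := p.comp (β.flip (h j))) (hd j) (fun i => ?_) x
  rw [mul_comm]
  exact hp i j

end GreatestSeminorm

/-! ### Continuous seminorms on projective tensor powers -/

section TensorPower

variable {𝕜 : Type*} [RCLike 𝕜] {E F W : Type*} [AddCommGroup E] [Module 𝕜 E]
  [AddCommGroup F] [Module 𝕜 F] [AddCommGroup W] [Module 𝕜 W]

theorem continuous_induced_linearEquiv_iff {tW : TopologicalSpace W} (e : F ≃ₗ[𝕜] W)
    {X : Type*} [TopologicalSpace X] (f : F → X) :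
    Continuous[TopologicalSpace.induced e tW, _] f ↔ Continuous fun w => f (e.symm w) := by
  let := TopologicalSpace.induced e tW
  constructor
  · exact fun h => h.comp (continuous_induced_rng.2 (by
      simpa [Function.comp_def] using continuous_id'))
  · intro h
    simpa [Function.comp_def] using h.comp (continuous_induced_dom (f := e))

theorem continuous_tmul_projectiveTopology (𝕜 : Type*) [RCLike 𝕜] {E F : Type*} [AddCommGroup E]
    [Module 𝕜 E] [AddCommGroup F] [Module 𝕜 F] (tE : TopologicalSpace E)
    (tF : TopologicalSpace F) :
    Continuous[_, projectiveTopology 𝕜 tE tF] fun z : E × F => z.1 ⊗ₜ[𝕜] z.2 :=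
  (isLeast_finestLocallyConvex 𝕜 (fun _ : Unit => @instTopologicalSpaceProd E F tE tF)
    (fun _ (p : E × F) => p.1 ⊗ₜ[𝕜] p.2)).1.2 ()

theorem continuous_lof_tensorAlgebraTopology (𝕜 : Type*) [RCLike 𝕜] {E : Type*} [AddCommGroup E]
    [Module 𝕜 E] (tE : TopologicalSpace E) (n : ℕ) :
    Continuous[tensorPowerTopology 𝕜 tE n, tensorAlgebraTopology 𝕜 tE]
      (DirectSum.lof 𝕜 ℕ (fun n => ⨂[𝕜]^n E) n) :=
  (isLeast_finestLocallyConvex 𝕜 (tensorPowerTopology 𝕜 tE)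
    (fun n => DirectSum.lof 𝕜 ℕ (fun n => ⨂[𝕜]^n E) n)).1.2 n

theorem Seminorm.continuous_projectiveTopology [tE : TopologicalSpace E]
    [tF : TopologicalSpace F] [IsTopologicalAddGroup E] [IsTopologicalAddGroup F]
    (p : Seminorm 𝕜 (E ⊗[𝕜] F)) {q : Seminorm 𝕜 E} {r : Seminorm 𝕜 F}
    (hq : Continuous q) (hr : Continuous r) (h : ∀ x y, p (x ⊗ₜ y) ≤ q x * r y) :
    Continuous[projectiveTopology 𝕜 tE tF, _] p :=
  p.continuous_finestLocallyConvex fun _ z =>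
    tendsto_seminorm_bilinear_sub (TensorProduct.mk 𝕜 E F) p hq hr h z

variable [tE : TopologicalSpace E]

theorem polynormableSpace_tensorPowerTopology [PolynormableSpace 𝕜 E] (n : ℕ) :
    @PolynormableSpace 𝕜 (⨂[𝕜]^n E) _ _ _ (tensorPowerTopology 𝕜 tE n) := by
  match n with
  | 0 =>
    exact PolynormableSpace.induced
      (PiTensorProduct.isEmptyEquiv (R := 𝕜) (s := fun _ => E) (Fin 0)).toLinearMap
  | 1 =>
    exact PolynormableSpace.induced
      (PiTensorProduct.subsingletonEquiv (R := 𝕜) (s := fun _ => E) (0 : Fin 1)).toLinearMap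
  | n + 2 =>
    let := projectiveTopology 𝕜 tE (tensorPowerTopology 𝕜 tE (n + 1))
    have : PolynormableSpace 𝕜 (E ⊗[𝕜] (⨂[𝕜]^(n + 1) E)) :=
      (isLeast_finestLocallyConvex 𝕜 _ _).1.1.polynormableSpace
    exact PolynormableSpace.induced (tensorPowerCons 𝕜 E (n + 1)).symm.toLinearMap

theorem exists_seminorm_tprod_le [PolynormableSpace 𝕜 E] (n : ℕ) (p : Seminorm 𝕜 (⨂[𝕜]^n E))
    (hp : Continuous[tensorPowerTopology 𝕜 tE n, _] p) :
    ∃ (C : ℝ) (q : Seminorm 𝕜 E), 0 ≤ C ∧ Continuous q ∧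
      ∀ v : Fin n → E, p (PiTensorProduct.tprod 𝕜 v) ≤ C * ∏ i, q (v i) := by
  have : IsTopologicalAddGroup E := (PolynormableSpace.withSeminorms 𝕜 E).topologicalAddGroup
  induction n with
  | zero =>
    refine ⟨p (PiTensorProduct.tprod 𝕜 Fin.elim0), 0, apply_nonneg _ _, continuous_zero,
      fun v => ?_⟩
    rw [Subsingleton.elim v Fin.elim0]
    simp
  | succ n ih =>
    obtain _ | n := n
    · refine ⟨1, p.comp
        (PiTensorProduct.subsingletonEquiv (R := 𝕜) (s := fun _ => E) (0 : Fin 1)).symm.toLinearMap,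
        zero_le_one, (continuous_induced_linearEquiv_iff _ _).1 hp, fun v => ?_⟩
      have : (PiTensorProduct.subsingletonEquiv (R := 𝕜) (s := fun _ => E) (0 : Fin 1)).symm
          (v 0) = PiTensorProduct.tprod 𝕜 v := by
        rw [LinearEquiv.symm_apply_eq, PiTensorProduct.subsingletonEquiv_apply_tprod]
      rw [one_mul]
      exact (congrArg p this).ge.trans (Fin.prod_univ_one (fun i : Fin 1 => p
        ((PiTensorProduct.subsingletonEquiv (R := 𝕜) (s := fun _ => E) (0 : Fin 1)).symm
          (v i)))).ge
    · let := tensorPowerTopology 𝕜 tE (n + 1)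
      have : PolynormableSpace 𝕜 (⨂[𝕜]^(n + 1) E) := polynormableSpace_tensorPowerTopology (n + 1)
      have hc := (continuous_induced_linearEquiv_iff _ _).1 hp
      obtain ⟨q, r, hq, hr, hqr⟩ := exists_seminorm_le_mul_of_continuous_bilinear
        (TensorProduct.mk 𝕜 E (⨂[𝕜]^(n + 1) E))
        (p.comp (tensorPowerCons 𝕜 E (n + 1)).toLinearMap)
        (@Continuous.comp _ _ _ _ (projectiveTopology 𝕜 tE (tensorPowerTopology 𝕜 tE (n + 1))) _
          _ _ hc (continuous_tmul_projectiveTopology 𝕜 tE (tensorPowerTopology 𝕜 tE (n + 1))))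
      obtain ⟨C, q', hC, hq', hrq⟩ := ih r hr
      -- The maximum lets one seminorm serve the new factor and all the old ones.
      refine ⟨C, q ⊔ q', hC, hq.sup hq', fun v => ?_⟩
      have h := hqr (v 0) (PiTensorProduct.tprod 𝕜 (Fin.tail v))
      rw [TensorProduct.mk_apply, Seminorm.comp_apply, LinearEquiv.coe_coe,
        tensorPowerCons_tmul_tprod, Fin.cons_self_tail] at h
      rw [Fin.prod_univ_succ, mul_left_comm]
      refine h.trans (mul_le_mul le_sup_left ((hrq _).trans ?_) (apply_nonneg _ _)
        (apply_nonneg _ _))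
      exact mul_le_mul_of_nonneg_left (Finset.prod_le_prod (fun _ _ => apply_nonneg _ _)
        fun _ _ => le_sup_right) hC

/-- Converse of `exists_seminorm_tprod_le`. In the induction `p (x ⊗ t)` is at most `q x` times the
greatest seminorm of `t` with bounds `C * ∏ q`, which is continuous by the induction hypothesis. -/
theorem continuous_seminorm_tensorPower [PolynormableSpace 𝕜 E] {q : Seminorm 𝕜 E}
    (hq : Continuous q) (n : ℕ) {C : ℝ} (hC : 0 ≤ C) (p : Seminorm 𝕜 (⨂[𝕜]^n E))
    (hp : ∀ v : Fin n → E, p (PiTensorProduct.tprod 𝕜 v) ≤ C * ∏ i, q (v i)) :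
    Continuous[tensorPowerTopology 𝕜 tE n, _] p := by
  have : IsTopologicalAddGroup E := (PolynormableSpace.withSeminorms 𝕜 E).topologicalAddGroup
  induction n generalizing C with
  | zero =>
    refine (continuous_induced_linearEquiv_iff _ _).2 ?_
    have : (fun w : 𝕜 => p ((PiTensorProduct.isEmptyEquiv (R := 𝕜) (s := fun _ => E)
        (Fin 0)).symm w)) = fun w => ‖w‖ * p ((PiTensorProduct.isEmptyEquiv (R := 𝕜)
        (s := fun _ => E) (Fin 0)).symm 1) := by
      funext w
      rw [← map_smul_eq_mul, ← map_smul, smul_eq_mul, mul_one]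
    rw [this]
    fun_prop
  | succ n ih =>
    obtain _ | n := n
    · refine (continuous_induced_linearEquiv_iff _ _).2 ?_
      refine Seminorm.continuous_of_le (p := p.comp (PiTensorProduct.subsingletonEquiv (R := 𝕜)
        (s := fun _ => E) (0 : Fin 1)).symm.toLinearMap) (q := C.toNNReal • q)
        (hq.const_smul C.toNNReal) fun x => ?_
      have h := hp fun _ => x
      rw [← PiTensorProduct.subsingletonEquiv_symm_apply' (R := 𝕜) (0 : Fin 1) x] at h
      simpa [NNReal.smul_def, hC] using h
    · let := tensorPowerTopology 𝕜 tE (n + 1)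
      have : PolynormableSpace 𝕜 (⨂[𝕜]^(n + 1) E) := polynormableSpace_tensorPowerTopology (n + 1)
      have : IsTopologicalAddGroup (⨂[𝕜]^(n + 1) E) :=
        (PolynormableSpace.withSeminorms 𝕜 (⨂[𝕜]^(n + 1) E)).topologicalAddGroup
      have hspan : Submodule.span 𝕜 (Set.range fun v : Fin (n + 1) → E =>
        PiTensorProduct.tprod 𝕜 v) = ⊤ := PiTensorProduct.span_tprod_eq_top
      have hnn (v : Fin (n + 1) → E) : 0 ≤ C * ∏ i, q (v i) :=
        mul_nonneg hC (Finset.prod_nonneg fun _ _ => apply_nonneg _ _)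
      refine (continuous_induced_linearEquiv_iff _ _).2
        (Seminorm.continuous_projectiveTopology (p.comp (tensorPowerCons 𝕜 E (n + 1)).toLinearMap)
          hq (ih hC (greatestSeminorm 𝕜 (fun v : Fin (n + 1) → E => PiTensorProduct.tprod 𝕜 v)
            fun v => C * ∏ i, q (v i)) (greatestSeminorm_apply_le hspan hnn)) fun x t => ?_)
      refine le_mul_greatestSeminorm hspan hnn (p := (p.comp (tensorPowerCons 𝕜 E
        (n + 1)).toLinearMap).comp (TensorProduct.mk 𝕜 E (⨂[𝕜]^(n + 1) E) x))
        (apply_nonneg q x) (fun v => ?_) t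
      have := hp (Fin.cons x v)
      rw [Fin.prod_univ_succ, mul_left_comm] at this
      simpa [tensorPowerCons_tmul_tprod] using this

end TensorPower

/-! ### Continuity of the multiplication of the tensor algebra -/

section TensorAlgebra

variable {𝕜 : Type*} [RCLike 𝕜] {E : Type*} [AddCommGroup E] [Module 𝕜 E]

theorem span_range_lof_tprod_eq_top : Submodule.span 𝕜 (Set.range
    fun a : Σ n, Fin n → E => DirectSum.lof 𝕜 ℕ (fun n => ⨂[𝕜]^n E) a.1
      (PiTensorProduct.tprod 𝕜 a.2)) = ⊤ := by
  refine eq_top_iff.2 fun x _ => ?_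
  induction x using DirectSum.induction_on with
  | zero => exact zero_mem _
  | add x y hx hy => exact add_mem (hx trivial) (hy trivial)
  | of n t =>
    have ht : t ∈ Submodule.span 𝕜
        (Set.range (PiTensorProduct.tprod 𝕜 (s := fun _ : Fin n => E))) := by
      rw [PiTensorProduct.span_tprod_eq_top]
      exact Submodule.mem_top
    have := Submodule.mem_map_of_mem (f := DirectSum.lof 𝕜 ℕ (fun n => ⨂[𝕜]^n E) n) ht
    rw [Submodule.map_span] at this
    refine Submodule.span_mono ?_ this
    rintro _ ⟨_, ⟨v, rfl⟩, rfl⟩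
    exact ⟨⟨n, v⟩, rfl⟩

theorem lof_tprod_mul_lof_tprod {m n : ℕ} (v : Fin m → E) (w : Fin n → E) :
    DirectSum.lof 𝕜 ℕ (fun n => ⨂[𝕜]^n E) m (PiTensorProduct.tprod 𝕜 v) *
      DirectSum.lof 𝕜 ℕ (fun n => ⨂[𝕜]^n E) n (PiTensorProduct.tprod 𝕜 w) =
    DirectSum.lof 𝕜 ℕ (fun n => ⨂[𝕜]^n E) (m + n) (PiTensorProduct.tprod 𝕜 (Fin.append v w)) := by
  simp only [DirectSum.lof_eq_of]
  rw [DirectSum.of_mul_of, TensorPower.tprod_mul_tprod]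

/-- A sequence of reals is dominated by an increasing sequence of reals which are at least `1`. -/
theorem exists_monotone_ge (M : ℕ → ℝ) : ∃ N : ℕ → ℝ, Monotone N ∧ ∀ n, M n ≤ N n ∧ 1 ≤ N n := by
  refine ⟨fun n => 1 + ∑ k ∈ Finset.range (n + 1), |M k|, fun m n h => ?_, fun n => ⟨?_, ?_⟩⟩
  · exact add_le_add_right (Finset.sum_le_sum_of_subset_of_nonneg
      (Finset.range_mono (by omega)) fun _ _ _ => abs_nonneg _) _
  · have := Finset.single_le_sum (f := fun k => |M k|) (fun _ _ => abs_nonneg _)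
      (Finset.self_mem_range_succ n)
    have := le_abs_self (M n)
    linarith
  · have := Finset.sum_nonneg (s := Finset.range (n + 1)) fun k _ => abs_nonneg (M k)
    linarith

/-- The tensor algebra of a locally convex space is a topological algebra if every sequence of
continuous seminorms is dominated, up to constants, by a single continuous seminorm. -/
theorem tensorAlgebraIsTopological_of_seminorms_dominated [tE : TopologicalSpace E]
    [PolynormableSpace 𝕜 E]
    (h : ∀ q : ℕ → Seminorm 𝕜 E, (∀ n, Continuous (q n)) →
      ∃ (r : Seminorm 𝕜 E) (C : ℕ → ℝ), Continuous r ∧ ∀ n x, q n x ≤ C n * r x) :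
    TensorAlgebraIsTopological 𝕜 tE := by
  let tA := tensorAlgebraTopology 𝕜 tE
  have hlc : IsLocallyConvexTopology 𝕜 tA := (isLeast_finestLocallyConvex 𝕜 _ _).1.1
  have := hlc.polynormableSpace
  have := hlc.isTopologicalAddGroup
  refine ⟨hlc.1, continuous_bilinear_of_seminorm (LinearMap.mul 𝕜 (⨁ n, ⨂[𝕜]^n E)) fun p hp => ?_⟩
  have hpn (n : ℕ) := exists_seminorm_tprod_le (tE := tE) n
    (p.comp (DirectSum.lof 𝕜 ℕ (fun n => ⨂[𝕜]^n E) n))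
    (@Continuous.comp _ _ _ (tensorPowerTopology 𝕜 tE n) tA _ _ _ hp
      (continuous_lof_tensorAlgebraTopology 𝕜 tE n))
  choose C q hC hq hpq using hpn
  obtain ⟨r, D, hr, hD⟩ := h q hq
  -- Replacing `q n` by `r` costs a factor `|D n|` in each of the `n` slots.
  obtain ⟨N, hNmono, hN⟩ := exists_monotone_ge fun n => C n * |D n| ^ n
  have hN0 (n : ℕ) : 0 ≤ N n := zero_le_one.trans (hN n).2
  have hprod {n : ℕ} (v : Fin n → E) : 0 ≤ ∏ i, r (v i) :=
    Finset.prod_nonneg fun _ _ => apply_nonneg _ _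
  have hpr (n : ℕ) (v : Fin n → E) :
      p (DirectSum.lof 𝕜 ℕ (fun n => ⨂[𝕜]^n E) n (PiTensorProduct.tprod 𝕜 v)) ≤
        N n * ∏ i, r (v i) := by
    refine (hpq n v).trans ?_
    calc C n * ∏ i, q n (v i) ≤ C n * ∏ i, |D n| * r (v i) :=
          mul_le_mul_of_nonneg_left (Finset.prod_le_prod (fun _ _ => apply_nonneg _ _)
            fun i _ => (hD n (v i)).trans
              (mul_le_mul_of_nonneg_right (le_abs_self _) (apply_nonneg _ _))) (hC n)
      _ = C n * |D n| ^ n * ∏ i, r (v i) := by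
          rw [Finset.prod_mul_distrib, Finset.prod_const, Finset.card_fin, mul_assoc]
      _ ≤ N n * ∏ i, r (v i) := mul_le_mul_of_nonneg_right (hN n).1 (hprod v)
  -- The doubled index separates degrees: `m + n` is at most twice the larger one, and the factor
  -- for the smaller one is at least `1`.
  have hc (a : Σ n, Fin n → E) : 0 ≤ N (2 * a.1) * ∏ i, r (a.2 i) :=
    mul_nonneg (hN0 _) (hprod _)
  have hspan := span_range_lof_tprod_eq_top (𝕜 := 𝕜) (E := E)
  have hQ : Continuous (greatestSeminorm 𝕜 (fun a : Σ n, Fin n → E =>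
      DirectSum.lof 𝕜 ℕ (fun n => ⨂[𝕜]^n E) a.1 (PiTensorProduct.tprod 𝕜 a.2))
      fun a => N (2 * a.1) * ∏ i, r (a.2 i)) := by
    have (n : ℕ) : @IsTopologicalAddGroup (⨂[𝕜]^n E) (tensorPowerTopology 𝕜 tE n) _ := by
      let := tensorPowerTopology 𝕜 tE n
      have := polynormableSpace_tensorPowerTopology (𝕜 := 𝕜) (tE := tE) n
      exact (PolynormableSpace.withSeminorms 𝕜 (⨂[𝕜]^n E)).topologicalAddGroup
    refine Seminorm.continuous_finestLocallyConvex_of_comp (tX := tensorPowerTopology 𝕜 tE) _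
      fun n => ?_
    exact continuous_seminorm_tensorPower hr n (hN0 (2 * n)) (Seminorm.comp _
      (DirectSum.lof 𝕜 ℕ (fun n => ⨂[𝕜]^n E) n))
      fun v => greatestSeminorm_apply_le hspan hc ⟨n, v⟩
  refine ⟨_, _, hQ, hQ, seminorm_bilinear_le_greatestSeminorm hspan hc hspan hc _ p ?_⟩
  rintro ⟨m, v⟩ ⟨n, w⟩
  rw [LinearMap.mul_apply', lof_tprod_mul_lof_tprod]
  have hmn : N (m + n) ≤ N (2 * m) * N (2 * n) := by
    rcases le_total m n with hle | hle
    · exact (hNmono (by omega)).trans (le_mul_of_one_le_left (hN0 _) (hN _).2)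
    · exact (hNmono (by omega)).trans (le_mul_of_one_le_right (hN0 _) (hN _).2)
  calc _ ≤ N (m + n) * ∏ i, r (Fin.append v w i) := hpr _ _
    _ = N (m + n) * ((∏ i, r (v i)) * ∏ i, r (w i)) := by
        rw [Fin.prod_univ_add]
        simp only [Fin.append_left, Fin.append_right]
    _ ≤ (N (2 * m) * N (2 * n)) * ((∏ i, r (v i)) * ∏ i, r (w i)) :=
        mul_le_mul_of_nonneg_right hmn (mul_nonneg (hprod v) (hprod w))
    _ = _ := by ring

end TensorAlgebra

/-! ### Dominating sequences of seminorms on `k_ω`-spaces -/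

section KOmega

theorem continuous_of_forall_continuousOn {X Y : Type*} [TopologicalSpace X] [TopologicalSpace Y]
    {K : ℕ → Set X} (hK : ∀ U : Set X, (∀ n, IsOpen ((↑) ⁻¹' U : Set (K n))) → IsOpen U)
    {f : X → Y} (hf : ∀ n, ContinuousOn f (K n)) : Continuous f :=
  continuous_def.2 fun _ hU => hK _ fun n => hU.preimage (hf n).domRestrict

/-- On a `k_ω`-space, every sequence of continuous seminorms is dominated, up to constants, by a
single continuous seminorm. -/
theorem IsKOmegaSpace.exists_seminorm_dominating {𝕜 : Type*} [RCLike 𝕜] {E : Type*}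
    [AddCommGroup E] [Module 𝕜 E] [TopologicalSpace E] (hE : IsKOmegaSpace E)
    (q : ℕ → Seminorm 𝕜 E) (hq : ∀ n, Continuous (q n)) :
    ∃ (r : Seminorm 𝕜 E) (C : ℕ → ℝ), Continuous r ∧ ∀ n x, q n x ≤ C n * r x := by
  obtain ⟨K, -, hKc, hKu, hKo⟩ := hE.exists_seq
  have hS (n m : ℕ) : ∃ S : ℝ, 0 ≤ S ∧ ∀ x ∈ K m, q n x ≤ S := by
    obtain ⟨S, hS⟩ := (hKc m).exists_bound_of_continuousOn (hq n).continuousOn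
    exact ⟨|S|, abs_nonneg S, fun x hx => (le_abs_self _).trans ((hS x hx).trans (le_abs_self S))⟩
  choose S hS0 hS using hS
  -- Diagonal weights: `a n * S n m ≤ 2⁻ⁿ` whenever `m ≤ n`, so for fixed `m` only finitely many
  -- terms escape the geometric bound.
  let a : ℕ → ℝ := fun n => (1 / 2) ^ n / (1 + ∑ m ∈ Finset.range (n + 1), S n m)
  have hden (n : ℕ) : 0 < 1 + ∑ m ∈ Finset.range (n + 1), S n m :=
    add_pos_of_pos_of_nonneg one_pos (Finset.sum_nonneg fun _ _ => hS0 _ _)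
  have ha (n : ℕ) : 0 < a n := div_pos (by positivity) (hden n)
  have haS {m n : ℕ} (h : m ≤ n) : a n * S n m ≤ (1 / 2) ^ n := by
    rw [div_mul_eq_mul_div, div_le_iff₀ (hden n)]
    have := Finset.single_le_sum (f := S n) (fun m _ => hS0 n m)
      (Finset.mem_range.2 (Nat.lt_succ_of_le h))
    exact mul_le_mul_of_nonneg_left (by linarith) (by positivity)
  have hsumS (m : ℕ) : Summable fun n => a n * S n m := by
    refine summable_geometric_two.of_norm_bounded_eventually_nat ?_
    filter_upwards [Filter.eventually_ge_atTop m] with n hn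
    rw [Real.norm_of_nonneg (mul_nonneg (ha n).le (hS0 n m))]
    exact haS hn
  have hbound (m n : ℕ) (x : E) (hx : x ∈ K m) : ‖a n * q n x‖ ≤ a n * S n m := by
    rw [Real.norm_of_nonneg (mul_nonneg (ha n).le (apply_nonneg _ x))]
    exact mul_le_mul_of_nonneg_left (hS n m x hx) (ha n).le
  have hsum (x : E) : Summable fun n => a n * q n x := by
    obtain ⟨m, hm⟩ := Set.mem_iUnion.1 (hKu ▸ Set.mem_univ x)
    exact (hsumS m).of_norm_bounded fun n => hbound m n x hm
  let r : Seminorm 𝕜 E := Seminorm.of (fun x => ∑' n, a n * q n x)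
    (fun x y => by
      rw [← (hsum x).tsum_add (hsum y)]
      refine (hsum _).tsum_le_tsum (fun n => ?_) ((hsum x).add (hsum y))
      rw [← mul_add]
      exact mul_le_mul_of_nonneg_left (map_add_le_add _ x y) (ha n).le)
    (fun c x => by
      rw [← tsum_mul_left]
      exact tsum_congr fun n => by rw [map_smul_eq_mul]; ring)
  -- The Weierstrass test gives continuity on each `K m`, which suffices for the limit topology.
  refine ⟨r, fun n => (a n)⁻¹, continuous_of_forall_continuousOn hKo fun m =>
    continuousOn_tsum (fun n => (continuous_const.mul (hq n)).continuousOn) (hsumS m)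
      (hbound m), fun n x => ?_⟩
  rw [le_inv_mul_iff₀ (ha n)]
  exact (hsum x).le_tsum n fun k _ => mul_nonneg (ha k).le (apply_nonneg _ x)

end KOmega

/-! ### Silva spaces as topological direct limits -/

section Silva

variable {𝕜 : Type*} [RCLike 𝕜]

theorem AbsConvex.image_linearMap {E F : Type*} [AddCommGroup E] [Module 𝕜 E] [AddCommGroup F]
    [Module 𝕜 F] {s : Set E} (hs : AbsConvex 𝕜 s) (f : E →ₗ[𝕜] F) : AbsConvex 𝕜 (f '' s) := by
  refine ⟨fun a ha => ?_, hs.2.linear_image f⟩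
  rintro _ ⟨_, ⟨x, hx, rfl⟩, rfl⟩
  exact ⟨a • x, hs.1 a ha ⟨x, hx, rfl⟩, map_smul f a x⟩

theorem absConvex_closedBall_zero {B : Type*} [NormedAddCommGroup B] [NormedSpace 𝕜 B] (r : ℝ) :
    AbsConvex 𝕜 (Metric.closedBall (0 : B) r) := by
  let : NormedSpace ℝ B := NormedSpace.restrictScalars ℝ 𝕜 B
  have : IsScalarTower ℝ 𝕜 B := ⟨fun a b x => by rw [Algebra.smul_def, mul_smul]; rfl⟩
  exact ⟨balanced_closedBall_zero, convex_of_nonneg_surjective_algebraMap (R := ℝ) _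
    (fun _ => RCLike.nonneg_iff_exists_ofReal.mp) (convex_closedBall _ _)⟩

variable {E : Type*} [AddCommGroup E] [Module 𝕜 E] {B : ℕ → Type*}
  [∀ n, NormedAddCommGroup (B n)] [∀ n, NormedSpace 𝕜 (B n)]
  {incl : ∀ n, B n →L[𝕜] B (n + 1)} {f : ∀ n, B n →ₗ[𝕜] E}

/-- An absolutely convex set whose preimages in all steps are zero neighbourhoods is a zero
neighbourhood in the locally convex direct limit. -/
theorem mem_nhds_zero_finestLocallyConvex_of_absConvex (hcover : ∀ y : E, ∃ n x, f n x = y)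
    {W : Set E} (hW : AbsConvex 𝕜 W) (hnhds : ∀ n, f n ⁻¹' W ∈ 𝓝 0) :
    W ∈ @nhds E (finestLocallyConvex 𝕜 (fun n => (inferInstance : TopologicalSpace (B n)))
      (fun n => (f n : B n → E))) 0 := by
  let : Module ℝ E := Module.compHom E (algebraMap ℝ 𝕜)
  have : IsScalarTower ℝ 𝕜 E := ⟨fun a b x => by rw [Algebra.smul_def, mul_smul]; rfl⟩
  have hconv : Convex ℝ W := hW.2.lift ℝ
  have habs : Absorbent ℝ W := by
    refine absorbent_iff_eventually_nhdsNE_zero.2 fun y => ?_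
    obtain ⟨n, x, rfl⟩ := hcover y
    have hc : Continuous fun c : ℝ => (c : 𝕜) • x := by fun_prop
    have := (hc.tendsto' 0 0 (by simp)).eventually (hnhds n)
    filter_upwards [this.filter_mono nhdsWithin_le_nhds] with c hc
    change (c : 𝕜) • f n x ∈ W
    rw [← map_smul]
    exact hc
  have h0 : (0 : E) ∈ W := by
    obtain ⟨n, x, hx⟩ := hcover 0
    have := mem_of_mem_nhds (hnhds n)
    rwa [Set.mem_preimage, map_zero] at this
  -- The gauge of `W` is at most `1` on a zero neighbourhood in each step, hence continuous, and its
  -- open unit ball lies in `W`.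
  let p : Seminorm 𝕜 E := gaugeSeminorm hW.1 hconv habs
  have hp : Continuous[finestLocallyConvex 𝕜 (fun n => (inferInstance : TopologicalSpace (B n)))
      (fun n => (f n : B n → E)), _] p := by
    refine p.continuous_finestLocallyConvex_of_comp fun n => ?_
    refine Seminorm.continuous' (p := p.comp (f n)) (r := 1)
      (Filter.mem_of_superset (hnhds n) fun x hx => ?_)
    rw [Seminorm.mem_closedBall_zero]
    exact gauge_le_one_of_mem hx
  let := finestLocallyConvex 𝕜 (fun n => (inferInstance : TopologicalSpace (B n)))
      (fun n => (f n : B n → E))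
  refine Filter.mem_of_superset ((isOpen_Iio.preimage hp).mem_nhds (?_ : p 0 < 1))
    (setOfPred_gauge_lt_one_subset_self hconv h0 habs)
  simp

/-- The inductive step in the construction of absolutely convex zero neighbourhoods in a Silva
space. -/
theorem IsCompactOperator.exists_absConvex_extension {X Y : Type*} [NormedAddCommGroup X]
    [NormedSpace 𝕜 X] [NormedAddCommGroup Y] [NormedSpace 𝕜 Y] {i : X →L[𝕜] Y}
    (hi : IsCompactOperator i) {A : Set X} (hA : IsCompact A) (hA' : AbsConvex 𝕜 A)
    (h0 : 0 ∈ A) {V : Set Y} (hV : IsOpen V) (hAV : i '' A ⊆ V) :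
    ∃ A' : Set Y, IsCompact A' ∧ AbsConvex 𝕜 A' ∧ 0 ∈ A' ∧ A' ⊆ V ∧ i '' A ⊆ A' ∧
      ∃ ε > 0, i '' Metric.closedBall 0 ε ⊆ A' := by
  have hiA : IsCompact (i '' A) := hA.image i.continuous
  obtain ⟨δ, hδ, hδV⟩ := hiA.exists_cthickening_subset_open hV hAV
  -- This makes `i` map the `ε`-ball into the `δ`-ball; the `1` avoids division by zero.
  set ε : ℝ := δ / (‖i‖ + 1)
  have hn : 0 < ‖i‖ + 1 := by positivity
  have hε : 0 < ε := div_pos hδ hn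
  set C : Set Y := closure (i '' Metric.closedBall 0 ε)
  have hsub : i '' Metric.closedBall 0 ε ⊆ C := subset_closure
  have hC0 : (0 : Y) ∈ C := hsub ⟨0, by simp [hε.le], map_zero i⟩
  have hCδ : C ⊆ Metric.closedBall 0 δ := by
    refine closure_minimal ?_ Metric.isClosed_closedBall
    rintro _ ⟨x, hx, rfl⟩
    rw [mem_closedBall_zero_iff] at hx ⊢
    calc ‖i x‖ ≤ ‖i‖ * ‖x‖ := i.le_opNorm x
      _ ≤ (‖i‖ + 1) * ε := by gcongr; linarith
      _ = δ := mul_div_cancel₀ _ hn.ne'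
  have hC : IsCompact C := IsCompactOperator.isCompact_closure_image_closedBall
    (f := i.toLinearMap) hi ε
  have hC' : AbsConvex 𝕜 C := ((absConvex_closedBall_zero ε).image_linearMap i.toLinearMap).closure
  have hiA' : AbsConvex 𝕜 (i '' A) := hA'.image_linearMap i.toLinearMap
  have hi0 : (0 : Y) ∈ i '' A := ⟨0, h0, map_zero i⟩
  -- The sum stays in the closed `δ`-thickening of the compact set `i '' A`, hence in `V`.
  open scoped Pointwise in
  refine ⟨i '' A + C, hiA.add hC, ⟨hiA'.1.add hC'.1, hiA'.2.add hC'.2⟩,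
    ⟨0, hi0, 0, hC0, add_zero 0⟩, ?_, fun y hy => ⟨y, hy, 0, hC0, add_zero y⟩, ε, hε,
    fun y hy => ⟨0, hi0, y, hsub hy, zero_add y⟩⟩
  refine (Set.add_subset_add_left hCδ).trans ?_
  rw [hiA.add_closedBall_zero hδ.le]
  exact hδV

theorem exists_continuousLinearMap_of_le (hf : ∀ n x, f (n + 1) (incl n x) = f n x) {m n : ℕ}
    (h : m ≤ n) : ∃ J : B m →L[𝕜] B n, ∀ x, f n (J x) = f m x := by
  induction n, h using Nat.le_induction with
  | base => exact ⟨.id 𝕜 _, fun _ => rfl⟩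
  | succ n _ ih =>
    obtain ⟨J, hJ⟩ := ih
    exact ⟨(incl n).comp J, fun x => by rw [ContinuousLinearMap.comp_apply, hf, hJ]⟩

/-- Compact absolutely convex sets `A n` inside the preimages of `U` are built recursively,
compactness leaving room to enlarge. `A (n + 1)` contains the image of a ball of `B n`, so the union
of the `f n '' A n` is a zero neighbourhood. -/
theorem mem_nhds_zero_of_forall_isOpen_preimage (hincl : ∀ n, IsCompactOperator (incl n))
    (hf : ∀ n x, f (n + 1) (incl n x) = f n x) (hcover : ∀ y : E, ∃ n x, f n x = y) {U : Set E}
    (h0 : (0 : E) ∈ U) (hU : ∀ n, IsOpen (f n ⁻¹' U)) :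
    U ∈ @nhds E (finestLocallyConvex 𝕜 (fun n => (inferInstance : TopologicalSpace (B n)))
      (fun n => (f n : B n → E))) 0 := by
  let P (n : ℕ) (A : Set (B n)) : Prop := IsCompact A ∧ AbsConvex 𝕜 A ∧ 0 ∈ A ∧ A ⊆ f n ⁻¹' U
  have step (n : ℕ) (A : {A // P n A}) : ∃ A' : {A' // P (n + 1) A'},
      incl n '' A.1 ⊆ A'.1 ∧ ∃ ε > 0, incl n '' Metric.closedBall 0 ε ⊆ A'.1 := by
    obtain ⟨A, hA, hA', hA0, hAU⟩ := A
    obtain ⟨A', h1, h2, h3, h4, h5⟩ := (hincl n).exists_absConvex_extension hA hA' hA0 (hU (n + 1))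
      (by rintro _ ⟨x, hx, rfl⟩
          rw [Set.mem_preimage, hf]
          exact hAU hx)
    exact ⟨⟨A', h1, h2, h3, h4⟩, h5⟩
  choose next hnext hball using step
  let A (n : ℕ) : {A // P n A} := Nat.rec ⟨{0}, isCompact_singleton,
    ⟨balanced_zero, convex_singleton 0⟩, rfl, by simpa using h0⟩ next n
  have hmono : Monotone fun n => f n '' (A n).1 := by
    refine monotone_nat_of_le_succ fun n => ?_
    rintro _ ⟨x, hx, rfl⟩
    exact ⟨incl n x, hnext n (A n) ⟨x, hx, rfl⟩, hf n x⟩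
  have habs (n : ℕ) : AbsConvex 𝕜 (f n '' (A n).1) := (A n).2.2.1.image_linearMap (f n)
  have hW : AbsConvex 𝕜 (⋃ n, f n '' (A n).1) :=
    ⟨balanced_iUnion fun n => (habs n).1,
      (hmono.directed_le).convex_iUnion fun n => (habs n).2⟩
  refine Filter.mem_of_superset
    (mem_nhds_zero_finestLocallyConvex_of_absConvex hcover hW fun n => ?_) ?_
  · obtain ⟨ε, hε, hsub⟩ := hball n (A n)
    refine Filter.mem_of_superset (Metric.closedBall_mem_nhds 0 hε) fun x hx => ?_
    exact Set.mem_iUnion.2 ⟨n + 1, incl n x, hsub ⟨x, hx, rfl⟩, hf n x⟩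
  · refine Set.iUnion_subset fun n => ?_
    rintro _ ⟨x, hx, rfl⟩
    exact (A n).2.2.2.2 hx

/-- In a Silva space, a set is open if its preimages in all steps are open. -/
theorem isOpen_of_forall_isOpen_preimage (hincl : ∀ n, IsCompactOperator (incl n))
    (hf : ∀ n x, f (n + 1) (incl n x) = f n x) (hcover : ∀ y : E, ∃ n x, f n x = y) {U : Set E}
    (hU : ∀ n, IsOpen (f n ⁻¹' U)) :
    IsOpen[finestLocallyConvex 𝕜 (fun n => (inferInstance : TopologicalSpace (B n)))
      (fun n => (f n : B n → E))] U := by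
  let := finestLocallyConvex 𝕜 (fun n => (inferInstance : TopologicalSpace (B n)))
      (fun n => (f n : B n → E))
  have : IsTopologicalAddGroup E :=
    (isLeast_finestLocallyConvex 𝕜 (fun n => (inferInstance : TopologicalSpace (B n)))
      (fun n => (f n : B n → E))).1.1.isTopologicalAddGroup
  refine isOpen_iff_mem_nhds.2 fun y hy => ?_
  have key : (fun z => z + y) ⁻¹' U ∈ 𝓝 (0 : E) := by
    refine mem_nhds_zero_of_forall_isOpen_preimage hincl hf hcover (by simpa using hy) fun n => ?_
    -- The translation by `y` is carried out in a common step containing both `B n` and the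
    -- representative of `y`.
    obtain ⟨m, x, rfl⟩ := hcover y
    obtain ⟨J, hJ⟩ := exists_continuousLinearMap_of_le (incl := incl) hf (le_max_left n m)
    obtain ⟨J', hJ'⟩ := exists_continuousLinearMap_of_le (incl := incl) hf (le_max_right n m)
    have hc : Continuous fun b => J b + J' x := by fun_prop
    have := (hU (max n m)).preimage hc
    simpa [Set.preimage_preimage, hJ, hJ'] using this
  have hc : Filter.Tendsto (fun z => z - y) (𝓝 y) (𝓝 0) :=
    (continuous_id.sub continuous_const).tendsto' y 0 (sub_self y)
  have hy' := Filter.mem_map.1 (hc key)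
  simpa [Set.preimage_preimage] using hy'

end Silva

/-- Every Silva space is a `k_ω`-space. -/
theorem IsSilvaSpace.isKOmegaSpace {𝕜 : Type u} [RCLike 𝕜] {E : Type v} [AddCommGroup E]
    [Module 𝕜 E] [tE : TopologicalSpace E] (h : IsSilvaSpace 𝕜 E) : IsKOmegaSpace E := by
  obtain ⟨B, _, _, incl, f, -, hincl, hinj, hf, hcover, rfl⟩ := h
  let := finestLocallyConvex 𝕜 (fun n => (inferInstance : TopologicalSpace (B n)))
      (fun n => (f n : B n → E))
  have hleast := (isLeast_finestLocallyConvex 𝕜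
    (fun n => (inferInstance : TopologicalSpace (B n))) (fun n => (f n : B n → E))).1
  have : IsTopologicalAddGroup E := hleast.1.isTopologicalAddGroup
  have hcont (n : ℕ) : Continuous (f n) := hleast.2 n
  have hopen {U : Set E} (hU : ∀ n, IsOpen (f n ⁻¹' U)) : IsOpen U :=
    isOpen_of_forall_isOpen_preimage hincl hf hcover hU
  -- Injectivity makes preimages of points closed; a T1 topological group is Hausdorff.
  have : T1Space E := ⟨fun y => ⟨hopen fun n => by
    rw [Set.preimage_compl]
    exact ((Set.subsingleton_singleton.preimage (hinj n)).isClosed).isOpen_compl⟩⟩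
  -- The closure is taken in `B (m + 1)`, where compactness of `incl m` makes it compact; `n` bounds
  -- both the steps and the radii.
  let K (n : ℕ) : Set E :=
    ⋃ m < n, f (m + 1) '' closure (incl m '' Metric.closedBall 0 n)
  have hmem {m n : ℕ} (hmn : m < n) (x : B m) (hx : ‖x‖ ≤ n) : f m x ∈ K n :=
    Set.mem_iUnion₂.2 ⟨m, hmn, incl m x,
      subset_closure ⟨x, mem_closedBall_zero_iff.2 hx, rfl⟩, hf m x⟩
  refine ⟨inferInstance, K, ?_, fun n => ?_, Set.eq_univ_of_forall fun y => ?_, fun U hU => ?_⟩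
  · intro n n' hn
    refine Set.iUnion₂_subset fun m hm => ?_
    refine Set.Subset.trans ?_ (Set.subset_iUnion₂ (s := fun m (_ : m < n') =>
      f (m + 1) '' closure (incl m '' Metric.closedBall 0 n')) m (hm.trans_le hn))
    gcongr
  · refine (Set.finite_lt_nat n).isCompact_biUnion fun m _ => ?_
    exact (IsCompactOperator.isCompact_closure_image_closedBall (f := (incl m).toLinearMap)
      (hincl m) n).image (hcont (m + 1))
  · obtain ⟨m, x, rfl⟩ := hcover y
    obtain ⟨k, hk⟩ := exists_nat_ge ‖x‖
    refine Set.mem_iUnion.2 ⟨max (m + 1) k, hmem (by omega) x (hk.trans ?_)⟩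
    exact_mod_cast le_max_right _ _
  -- Near `b` the map `f m` factors through `K n` on the ball of radius `n`, so openness in `K n`
  -- pulls back.
  · refine hopen fun m => isOpen_iff_forall_mem_open.2 fun b hb => ?_
    obtain ⟨k, hk⟩ := exists_nat_gt ‖b‖
    let n := max (m + 1) k
    have hkn : (k : ℝ) ≤ n := by exact_mod_cast le_max_right _ _
    let g : Metric.ball (0 : B m) n → K n := fun x => ⟨f m x.1, hmem (by omega) x.1
      (mem_ball_zero_iff.1 x.2).le⟩
    have hg : Continuous g := ((hcont m).comp continuous_subtype_val).subtype_mk _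
    refine ⟨_, ?_, Metric.isOpen_ball.isOpenMap_subtype_val _ ((hU n).preimage hg),
      ⟨b, mem_ball_zero_iff.2 (hk.trans_le hkn)⟩, hb, rfl⟩
    rintro _ ⟨x, hx, rfl⟩
    exact hx

/-! ### Convexifications and the main theorem -/

/-- The convexification of a `k_ω` vector topology makes the tensor algebra a topological
algebra. -/
theorem IsKOmegaSpace.tensorAlgebraIsTopological_convexification {𝕜 : Type*} [RCLike 𝕜]
    {E : Type*} [AddCommGroup E] [Module 𝕜 E] {tF : TopologicalSpace E}
    (hF : IsVectorTopology 𝕜 tF) (h : IsKOmegaSpace E) :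
    TensorAlgebraIsTopological 𝕜 (convexification 𝕜 tF) := by
  have hleast := isLeast_convexification 𝕜 tF
  have : @PolynormableSpace 𝕜 E _ _ _ (convexification 𝕜 tF) := hleast.1.1.polynormableSpace
  refine @tensorAlgebraIsTopological_of_seminorms_dominated 𝕜 _ E _ _ (convexification 𝕜 tF) this
    fun q hq => ?_
  obtain ⟨r, C, hr, hC⟩ := h.exists_seminorm_dominating q
    fun n => continuous_le_dom hleast.1.2 (hq n)
  have := hF.isTopologicalAddGroup
  -- Continuity of `r` for `tF` makes its topology a locally convex one coarser than `tF`, hence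
  -- coarser than the convexification.
  refine ⟨r, C, continuous_le_dom (hleast.2 ⟨r.isLocallyConvexTopology_topology, ?_⟩)
    r.continuous_topology, hC⟩
  refine continuous_id_iff_le.1 (r.continuous_topology_rng fun x => ?_)
  have : Continuous fun y => r (y - x) := hr.comp (continuous_id.sub continuous_const)
  simpa using this.tendsto x

theorem mainTheorem4 {𝕜 : Type*} [RCLike 𝕜] {E : Type*} [AddCommGroup E] [Module 𝕜 E]
    [tE : TopologicalSpace E] [IsTopologicalAddGroup E] [ContinuousSMul 𝕜 E]
    [LocallyConvexSpace 𝕜 E] :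
    ((∃ tF : TopologicalSpace E, IsVectorTopology 𝕜 tF ∧ @IsKOmegaSpace E tF ∧
        tE = convexification 𝕜 tF) →
      TensorAlgebraIsTopological 𝕜 tE) ∧
    (IsKOmegaSpace E → TensorAlgebraIsTopological 𝕜 tE) ∧
    (IsSilvaSpace 𝕜 E →
      IsKOmegaSpace E ∧ TensorAlgebraIsTopological 𝕜 tE) := by
  have hv : IsVectorTopology 𝕜 tE := ⟨inferInstance, inferInstance⟩
  have hlc : tE = convexification 𝕜 tE :=
    le_antisymm (isLeast_convexification 𝕜 tE).1.2
      ((isLeast_convexification 𝕜 tE).2 ⟨⟨hv, inferInstance⟩, le_rfl⟩)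
  have h1 : (∃ tF : TopologicalSpace E, IsVectorTopology 𝕜 tF ∧ @IsKOmegaSpace E tF ∧
        tE = convexification 𝕜 tF) → TensorAlgebraIsTopological 𝕜 tE := by
    rintro ⟨tF, hF, hk, heq⟩
    rw [heq]
    exact hk.tensorAlgebraIsTopological_convexification hF
  exact ⟨h1, fun hk => h1 ⟨tE, hv, hk, hlc⟩, fun hs =>
    ⟨hs.isKOmegaSpace, h1 ⟨tE, hv, hs.isKOmegaSpace, hlc⟩⟩⟩
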